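/- Let $p\in\{1,2\}$. There exist constants $C_p,c_{p0},c_{p1},\kappa_p>0$ and $s_p\in(0,1)$, depending only on $p$, such that the following holds for all integers $m,n\ge 0$ with $m\ge c_{p0}\,n$ and every random matrix $A\in\mathbb{R}^{m\times n}$ whose entries are i.i.d. standard Gaussian $N(0,1)$. With probability at least $1-C_p\exp(-c_{p1}m)$ the matrix $A$ has the following property, simultaneously for all $x_*\in\mathbb{R}^n$ (with $x_*\neq 0$ if $p=2$) and all $b\in\mathbb{R}^m$ satisfying $\|\,|Ax_*|^p-b\,\|_0\le s_p m$ (in particular uniformly over all supports of the noise of size at most $s_pm$): the function $$f_p(x)=\frac1m\big\|\,|Ax|^p-b\,\big\|_1,\qquad x\in\mathbb{R}^n,$$ has $\{x_*,-x_*\}$ as its set of global minimizers and is sharp with respect to it, namely $$f_p(x)\ \ge\ \min_{\mathbb{R}^n} f_p+\mu\,\operatorname{dist}\big(x,\{x_*,-x_*\}\big)\qquad\text{for all }x\in\mathbb{R}^n,$$ with $\mu=\kappa_1>0$ if $p=1$ and $\mu=\kappa_2\|x_*\|>0$ if $p=2$. Here $|\cdot|$ and the power $p$ act entrywise, $\|v\|_0$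 is the number of nonzero entries of $v$, $\|\cdot\|$ is the Euclidean norm, $\operatorname{dist}(x,S)=\inf_{y\in S}\|x-y\|$, and for $m=0$ we read $f_p=0$. -/

import Mathlib

open MeasureTheory ProbabilityTheory

noncomputable section

/-- The entries of the random `m × n` matrix `A` are i.i.d. standard Gaussians `N(0, 1)`. -/
structure IsStdGaussianMatrix {Ω : Type*} [MeasurableSpace Ω] {m n : ℕ}
    (A : Ω → Matrix (Fin m) (Fin n) ℝ) (P : Measure Ω) : Prop where
  hasLaw : ∀ i j, HasLaw (fun ω => A ω i j) (gaussianReal 0 1) P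
  indep : iIndepFun (fun (ij : Fin m × Fin n) (ω : Ω) => A ω ij.1 ij.2) P

/-- The residual vector `|Ax|^p - b`, where absolute value and power are taken entrywise. -/
def phaseResidual {m n : ℕ} (p : ℕ) (A : Matrix (Fin m) (Fin n) ℝ) (b : Fin m → ℝ)
    (x : EuclideanSpace ℝ (Fin n)) : Fin m → ℝ :=
  fun i => |A.mulVec (fun j => x j) i| ^ p - b i

/-- The objective `f_p(x) = (1/m) ‖ |Ax|^p - b ‖₁`. -/
def phaseObjective {m n : ℕ} (p : ℕ) (A : Matrix (Fin m) (Fin n) ℝ) (b : Fin m → ℝ)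
    (x : EuclideanSpace ℝ (Fin n)) : ℝ :=
  (1 / (m : ℝ)) * ∑ i, |phaseResidual p A b x i|

/-- The set of global minimizers of `f`. -/
def minimizerSet {E : Type*} (f : E → ℝ) : Set E := {x | ∀ y, f x ≤ f y}

/-- `f` is sharp with respect to its set of minimizers, with constant `μ > 0`. -/
def IsSharpWith {E : Type*} [PseudoMetricSpace E] (f : E → ℝ) (μ : ℝ) : Prop :=
  0 < μ ∧ (minimizerSet f).Nonempty ∧
    ∀ x, (⨅ y, f y) + μ * Metric.infDist x (minimizerSet f) ≤ f x

end

/-! Write `D i` for the absolute difference of `|Ax|^p` and `|Az|^p` at entry `i`. Noise supported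
on `S` costs at most twice the sum of `D` over `S`, so f(x) - f(z) ≥ (1/m)(∑ D - 2 ∑_S D)
(`phaseObjective_add_le`). Each `D i` is the minimum (p = 1) or the product (p = 2) of the moduli of
the entries of A(x - z) and A(x + z). Sharpness thus follows from two facts uniform in the vector
`y`: at most m/4 entries of `Ay` lie below `δ‖y‖`, and every set of at most `s m` rows carries
little of the energy of `Ay` (`sharp_phaseObjective`).

Both are proved on a net of the sphere and extended by approximation. At a net point, Chernoff
bounds control the number of small entries and the truncated energy `∑ max (y i ^ 2 - T) 0`. The
latter bounds the energy on every `S` at once, up to `T * S.card`, so no union bound over supports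
is needed. The union bound over the net costs R^n, absorbed by m ≥ c₀ n. -/

/-! ### Law of a Gaussian matrix applied to a fixed vector -/

theorem IsStdGaussianMatrix.hasGaussianLaw {Ω : Type*} [MeasurableSpace Ω] {P : Measure Ω}
    {m n : ℕ} {A : Ω → Matrix (Fin m) (Fin n) ℝ} (hA : IsStdGaussianMatrix A P) :
    HasGaussianLaw (fun ω (ij : Fin m × Fin n) => A ω ij.1 ij.2) P :=
  hA.indep.hasGaussianLaw fun ij => (hA.hasLaw ij.1 ij.2).hasGaussianLaw

theorem IsStdGaussianMatrix.covariance_entries {Ω : Type*} [MeasurableSpace Ω] {P : Measure Ω}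
    [IsProbabilityMeasure P]
    {m n : ℕ} {A : Ω → Matrix (Fin m) (Fin n) ℝ} (hA : IsStdGaussianMatrix A P)
    (a b : Fin m × Fin n) :
    cov[fun ω => A ω a.1 a.2, fun ω => A ω b.1 b.2; P] = if a = b then 1 else 0 := by
  have hL : ∀ a : Fin m × Fin n, MemLp (fun ω => A ω a.1 a.2) 2 P := fun a =>
    (hA.hasLaw a.1 a.2).hasGaussianLaw.memLp_two
  split_ifs with h
  · subst h
    rw [covariance_self (hA.hasLaw a.1 a.2).aemeasurable, (hA.hasLaw a.1 a.2).variance_eq,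
      variance_id_gaussianReal]
    simp
  · exact (hA.indep.indepFun h).covariance_eq_zero (hL a) (hL b)

theorem IsStdGaussianMatrix.covariance_mulVec {Ω : Type*} [MeasurableSpace Ω] {P : Measure Ω}
    [IsProbabilityMeasure P]
    {m n : ℕ} {A : Ω → Matrix (Fin m) (Fin n) ℝ} (hA : IsStdGaussianMatrix A P)
    (w : Fin n → ℝ) (i k : Fin m) :
    cov[fun ω => (A ω).mulVec w i, fun ω => (A ω).mulVec w k; P]
      = if i = k then ∑ j, w j ^ 2 else 0 := by
  have hL : ∀ i j, MemLp (fun ω => A ω i j * w j) 2 P := fun i j =>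
    (hA.hasLaw i j).hasGaussianLaw.memLp_two.mul_const _
  simp only [Matrix.mulVec, dotProduct]
  rw [covariance_fun_sum_fun_sum (hL i) (hL k)]
  simp only [covariance_mul_const_left, covariance_mul_const_right]
  have := fun j l => hA.covariance_entries (i, j) (k, l)
  simp only [Prod.mk.injEq] at this
  simp only [this]
  split_ifs with h
  · subst h
    simp [sq]
  · simp [h]

theorem IsStdGaussianMatrix.hasGaussianLaw_mulVec {Ω : Type*} [MeasurableSpace Ω] {P : Measure Ω}
    {m n : ℕ} {A : Ω → Matrix (Fin m) (Fin n) ℝ} (hA : IsStdGaussianMatrix A P)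
    (w : Fin n → ℝ) : HasGaussianLaw (fun ω i => (A ω).mulVec w i) P := by
  have := hA.hasGaussianLaw.map_fun (ContinuousLinearMap.pi fun i : Fin m =>
    ∑ j, w j • ContinuousLinearMap.proj (R := ℝ) (φ := fun _ : Fin m × Fin n => ℝ) (i, j))
  convert! this using 3
  simp [Matrix.mulVec, dotProduct, mul_comm]

/-- Jointly Gaussian and uncorrelated coordinates are independent. -/
theorem IsStdGaussianMatrix.iIndepFun_mulVec {Ω : Type*} [MeasurableSpace Ω] {P : Measure Ω}
    [IsProbabilityMeasure P]
    {m n : ℕ} {A : Ω → Matrix (Fin m) (Fin n) ℝ} (hA : IsStdGaussianMatrix A P)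
    (w : Fin n → ℝ) : iIndepFun (fun i ω => (A ω).mulVec w i) P :=
  (hA.hasGaussianLaw_mulVec w).iIndepFun_of_covariance_eq_zero fun i k h => by
    rw [hA.covariance_mulVec, if_neg h]

theorem IsStdGaussianMatrix.hasLaw_mulVec {Ω : Type*} [MeasurableSpace Ω] {P : Measure Ω}
    [IsProbabilityMeasure P]
    {m n : ℕ} {A : Ω → Matrix (Fin m) (Fin n) ℝ} (hA : IsStdGaussianMatrix A P)
    {w : EuclideanSpace ℝ (Fin n)} (hw : ‖w‖ = 1) (i : Fin m) :
    HasLaw (fun ω => (A ω).mulVec (fun j => w j) i) (gaussianReal 0 1) P := by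
  have hG : HasGaussianLaw (fun ω => (A ω).mulVec (fun j => w j) i) P :=
    (hA.hasGaussianLaw_mulVec _).eval i
  refine ⟨hG.aemeasurable, ?_⟩
  rw [hG.map_eq_gaussianReal]
  have hmean : P[fun ω => (A ω).mulVec (fun j => w j) i] = 0 := by
    simp only [Matrix.mulVec, dotProduct]
    rw [integral_finsetSum _ fun j _ => (hA.hasLaw i j).hasGaussianLaw.integrable.mul_const _]
    refine Finset.sum_eq_zero fun j _ => ?_
    rw [integral_mul_const, (hA.hasLaw i j).integral_eq, integral_id_gaussianReal, zero_mul]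
  have hvar : Var[fun ω => (A ω).mulVec (fun j => w j) i; P] = 1 := by
    rw [← covariance_self hG.aemeasurable, hA.covariance_mulVec, if_pos rfl,
      ← EuclideanSpace.real_norm_sq_eq, hw, one_pow]
  rw [hmean, hvar, Real.toNNReal_one]

/-! ### Chernoff bound and Gaussian exponential moments -/

/-- Chernoff bound for a sum of independent copies of `h(X)`. -/
theorem measureReal_mul_le_sum_le {Ω : Type*} [MeasurableSpace Ω] {P : Measure Ω}
    [IsProbabilityMeasure P] {ν : Measure ℝ} {m : ℕ} {X : Fin m → Ω → ℝ}
    (hX : ∀ i, HasLaw (X i) ν P) (hi : iIndepFun X P) {h : ℝ → ℝ} (hh : Measurable h)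
    (hint : Integrable (fun x => Real.exp (h x)) ν) {a : ℝ}
    (ha : ∫ x, Real.exp (h x) ∂ν ≤ Real.exp a) (b : ℝ) :
    P.real {ω | b * m ≤ ∑ i, h (X i ω)} ≤ Real.exp ((a - b) * m) := by
  have hY : iIndepFun (fun i ω => h (X i ω)) P := hi.comp (fun _ => h) fun _ => hh
  have hm : ∀ i, AEMeasurable (fun ω => h (X i ω)) P := fun i =>
    hh.comp_aemeasurable (hX i).aemeasurable
  have hmgf : ∀ i, mgf (fun ω => h (X i ω)) P 1 ≤ Real.exp a := fun i => by
    simp only [mgf, one_mul]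
    rw [← (hX i).integral_comp (f := fun x => Real.exp (h x)) hint.aestronglyMeasurable] at ha
    exact ha
  have hsum : mgf (∑ i, fun ω => h (X i ω)) P 1 ≤ Real.exp (a * m) := by
    rw [hY.mgf_sum₀ hm]
    calc _ ≤ ∏ _i : Fin m, Real.exp a :=
          Finset.prod_le_prod (fun i _ => mgf_nonneg) fun i _ => hmgf i
      _ = _ := by simp [← Real.exp_nat_mul, mul_comm]
  have hI : Integrable (fun ω => Real.exp (1 * (∑ i, fun ω => h (X i ω)) ω)) P := by
    -- A non-integrable function has integral 0 by convention, so positivity of the mgf gives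
    -- integrability.
    refine not_imp_comm.1 integral_undef (ne_of_gt ?_)
    change 0 < mgf (∑ i, fun ω => h (X i ω)) P 1
    rw [hY.mgf_sum₀ hm]
    refine Finset.prod_pos fun i _ => mgf_pos ?_
    simp only [one_mul]
    rw [← (hX i).map_eq] at hint
    exact hint.comp_aemeasurable (hX i).aemeasurable
  have := measure_ge_le_exp_mul_mgf (b * m) zero_le_one hI
  simp only [Finset.sum_apply] at this
  refine this.trans ?_
  calc _ ≤ Real.exp (-1 * (b * m)) * Real.exp (a * m) := by gcongr
    _ = _ := by rw [← Real.exp_add]; ring_nf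

theorem integrable_exp_sq_div_four_gaussianReal :
    Integrable (fun x : ℝ => Real.exp (x ^ 2 / 4)) (gaussianReal 0 1) := by
  rw [gaussianReal_of_var_ne_zero _ one_ne_zero,
    integrable_withDensity_iff_integrable_smul' (measurable_gaussianPDF _ _) (by simp [gaussianPDF])]
  have := (integrable_exp_neg_mul_sq (b := 1 / 4) (by norm_num)).const_mul
    (√(2 * Real.pi))⁻¹
  refine this.congr (ae_of_all _ fun x => ?_)
  simp only [toReal_gaussianPDF, gaussianPDFReal, smul_eq_mul, NNReal.coe_one, mul_one, sub_zero]
  rw [mul_assoc, ← Real.exp_add]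
  ring_nf

theorem exp_max_le (T x : ℝ) :
    Real.exp (max (x ^ 2 - T) 0 / 4) ≤ 1 + Real.exp (-T / 4) * Real.exp (x ^ 2 / 4) := by
  rw [← Real.exp_add]
  rcases max_cases (x ^ 2 - T) 0 with ⟨h, _⟩ | ⟨h, _⟩ <;> rw [h]
  · rw [show -T / 4 + x ^ 2 / 4 = (x ^ 2 - T) / 4 by ring]; linarith
  · simp [(Real.exp_pos _).le]

theorem integrable_exp_max_gaussianReal (T : ℝ) :
    Integrable (fun x : ℝ => Real.exp (max (x ^ 2 - T) 0 / 4)) (gaussianReal 0 1) :=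
  Integrable.mono' ((integrable_const 1).add
    (integrable_exp_sq_div_four_gaussianReal.const_mul (Real.exp (-T / 4))))
    (by fun_prop) (ae_of_all _ fun x => by
      rw [Real.norm_of_nonneg (Real.exp_pos _).le]; exact exp_max_le T x)

/-- By `exp_max_le` the integral is at most 1 + e^(-T/4) M with M finite, which tends to 1 as T
grows. -/
theorem exists_integral_exp_max_le {ε : ℝ} (hε : 0 < ε) :
    ∃ T : ℝ, 0 < T ∧
      ∫ x, Real.exp (max (x ^ 2 - T) 0 / 4) ∂(gaussianReal 0 1) ≤ Real.exp ε := by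
  set M := ∫ x, Real.exp (x ^ 2 / 4) ∂(gaussianReal 0 1) with hM
  have hlim : Filter.Tendsto (fun T : ℝ => Real.exp (-T / 4) * M) Filter.atTop (nhds 0) := by
    have h1 : Filter.Tendsto (fun T : ℝ => -(T / 4)) Filter.atTop Filter.atBot :=
      Filter.tendsto_neg_atTop_atBot.comp (Filter.tendsto_id.atTop_div_const (by norm_num))
    have := (Real.tendsto_exp_atBot.comp h1).mul_const M
    simpa [Function.comp_def, neg_div] using this
  obtain ⟨T, hT, hT0⟩ := ((hlim.eventually (gt_mem_nhds hε)).and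
    (Filter.eventually_gt_atTop 0)).exists
  refine ⟨T, hT0, ?_⟩
  calc _ ≤ ∫ x, (1 + Real.exp (-T / 4) * Real.exp (x ^ 2 / 4)) ∂(gaussianReal 0 1) :=
        integral_mono (integrable_exp_max_gaussianReal T) ((integrable_const 1).add
          (integrable_exp_sq_div_four_gaussianReal.const_mul _)) (exp_max_le T)
    _ = 1 + Real.exp (-T / 4) * M := by
        rw [integral_add (integrable_const 1)
          (integrable_exp_sq_div_four_gaussianReal.const_mul _), integral_const_mul]
        simp [hM]
    _ ≤ Real.exp ε := by linarith [Real.add_one_le_exp ε]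

theorem exp_indicator_eq (θ r x : ℝ) :
    Real.exp (if |x| < r then θ else 0) = 1 + (Metric.ball (0 : ℝ) r).indicator
      (fun _ => Real.exp θ - 1) x := by
  by_cases h : |x| < r <;> simp [h, Set.indicator]

/-- The Gaussian has no atom at 0, so a small enough ball has mass beating the weight e^θ, however
large. -/
theorem exists_integral_exp_indicator_le (θ : ℝ) {ε : ℝ} (hε : 0 < ε) :
    ∃ r : ℝ, 0 < r ∧
      Integrable (fun x : ℝ => Real.exp (if |x| < r then θ else 0)) (gaussianReal 0 1) ∧
      ∫ x, Real.exp (if |x| < r then θ else 0) ∂(gaussianReal 0 1) ≤ Real.exp ε := by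
  have hν : gaussianReal 0 1 {0} = 0 := by
    have := nullSingletonClass_gaussianReal (μ := 0) (v := 1) one_ne_zero
    exact measure_singleton _
  obtain ⟨U, hU, hUo, hUε⟩ := Set.exists_isOpen_lt_of_lt ({0} : Set ℝ) (μ := gaussianReal 0 1)
    (ENNReal.ofReal (ε * Real.exp (-θ))) (by rw [hν]; simp; positivity)
  obtain ⟨r, hr, hrU⟩ := Metric.isOpen_iff.1 hUo 0 (hU rfl)
  have hb : (gaussianReal 0 1).real (Metric.ball 0 r) ≤ ε * Real.exp (-θ) :=
    ENNReal.toReal_le_of_le_ofReal (by positivity) ((measure_mono hrU).trans hUε.le)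
  have hI : Integrable ((Metric.ball (0 : ℝ) r).indicator fun _ => Real.exp θ - 1)
      (gaussianReal 0 1) := (integrable_const _).indicator Metric.isOpen_ball.measurableSet
  simp only [exp_indicator_eq]
  refine ⟨r, hr, (integrable_const 1).add hI, ?_⟩
  rw [integral_add (integrable_const 1) hI,
    integral_indicator_const _ Metric.isOpen_ball.measurableSet]
  calc _ ≤ 1 + ε * Real.exp (-θ) * Real.exp θ := by
        simp only [integral_const, probReal_univ, smul_eq_mul, mul_one]
        have : (gaussianReal 0 1).real (Metric.ball 0 r) * (Real.exp θ - 1)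
            ≤ (gaussianReal 0 1).real (Metric.ball 0 r) * Real.exp θ := by
          gcongr; linarith
        have h2 := mul_le_mul_of_nonneg_right hb (Real.exp_pos θ).le
        linarith
    _ = 1 + ε := by rw [mul_assoc, ← Real.exp_add]; simp
    _ ≤ Real.exp ε := by linarith [Real.add_one_le_exp ε]

/-! ### Nets of the unit sphere -/

section Net

variable {E : Type*} [NormedAddCommGroup E] [NormedSpace ℝ E] [FiniteDimensional ℝ E]

/-- Volume comparison: the disjoint balls of radius η/2 around the points lie in the ball of radius
1 + η/2. -/
theorem card_le_of_separated_of_norm_eq_one {η : ℝ} (hη : 0 < η) (s : Finset E)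
    (hs : ∀ c ∈ s, ‖c‖ = 1) (h : ∀ c ∈ s, ∀ d ∈ s, c ≠ d → η < ‖c - d‖) :
    (s.card : ℝ) ≤ (1 + 2 / η) ^ Module.finrank ℝ E := by
  borelize E
  let μ : Measure E := Measure.addHaar
  have δpos : 0 < η / 2 := by positivity
  have ρpos : 0 < 1 + η / 2 := by positivity
  have hD : Set.Pairwise (s : Set E)
      (Function.onFun Disjoint fun c => Metric.ball (c : E) (η / 2)) := by
    rintro c hc d hd hcd
    apply Metric.ball_disjoint_ball
    rw [dist_eq_norm]
    linarith [h c hc d hd hcd]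
  have hsub : (⋃ c ∈ s, Metric.ball (c : E) (η / 2)) ⊆ Metric.ball (0 : E) (1 + η / 2) := by
    refine Set.iUnion₂_subset fun x hx => Metric.ball_subset_ball' ?_
    rw [dist_zero_right, hs x hx, add_comm]
  have I : (s.card : ENNReal) * ENNReal.ofReal ((η / 2) ^ Module.finrank ℝ E)
        * μ (Metric.ball 0 1)
      ≤ ENNReal.ofReal ((1 + η / 2) ^ Module.finrank ℝ E) * μ (Metric.ball 0 1) := by
    rw [← μ.addHaar_ball_of_pos _ ρpos]
    refine le_trans (le_of_eq ?_) (measure_mono hsub)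
    rw [measure_biUnion_finset hD fun c _ => measurableSet_ball]
    simp only [μ.addHaar_ball_of_pos _ δpos, Finset.sum_const, nsmul_eq_mul, mul_assoc]
  have J := (ENNReal.mul_le_mul_iff_left (Metric.measure_ball_pos _ _ zero_lt_one).ne'
    measure_ball_lt_top.ne).1 I
  have K := ENNReal.toReal_le_of_le_ofReal (by positivity) J
  rw [ENNReal.toReal_mul, ENNReal.toReal_natCast, ENNReal.toReal_ofReal (by positivity),
    ← le_div_iff₀ (by positivity), ← div_pow] at K
  rwa [show 1 + 2 / η = (1 + η / 2) / (η / 2) by field_simp; ring]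

/-- A separated set of maximal cardinality is a net, since an uncovered point could be added to it.
-/
theorem exists_net_sphere {η : ℝ} (hη : 0 < η) :
    ∃ N : Finset E, (∀ w ∈ N, ‖w‖ = 1) ∧ (∀ x : E, ‖x‖ = 1 → ∃ w ∈ N, ‖x - w‖ ≤ η) ∧
      (N.card : ℝ) ≤ (1 + 2 / η) ^ Module.finrank ℝ E := by
  classical
  let good : Set ℕ := {k | ∃ s : Finset E, (∀ c ∈ s, ‖c‖ = 1) ∧
    (∀ c ∈ s, ∀ d ∈ s, c ≠ d → η < ‖c - d‖) ∧ s.card = k}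
  have hbdd : BddAbove good := by
    refine ⟨⌊(1 + 2 / η) ^ Module.finrank ℝ E⌋₊, ?_⟩
    rintro k ⟨s, h1, h2, rfl⟩
    exact Nat.le_floor (card_le_of_separated_of_norm_eq_one hη s h1 h2)
  have hne : good.Nonempty := ⟨0, ∅, by simp, by simp, rfl⟩
  obtain ⟨N, h1, h2, hk⟩ := Nat.sSup_mem hne hbdd
  refine ⟨N, h1, fun x hx => ?_, card_le_of_separated_of_norm_eq_one hη N h1 h2⟩
  by_contra! hfar
  have hxN : x ∉ N := fun hxN => by
    have := hfar x hxN
    simp at this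
    linarith
  have hmem : (insert x N).card ∈ good := by
    refine ⟨insert x N, ?_, ?_, rfl⟩
    · simpa [hx] using h1
    · intro c hc d hd hcd
      rw [Finset.mem_insert] at hc hd
      rcases hc with rfl | hc <;> rcases hd with rfl | hd
      · exact absurd rfl hcd
      · exact hfar d hd
      · rw [norm_sub_rev]; exact hfar c hc
      · exact h2 c hc d hd hcd
  have := le_csSup hbdd hmem
  rw [Finset.card_insert_of_notMem hxN, ← hk] at this
  omega

end Net

/-! ### From the net to all vectors -/

theorem opNorm_le_two_mul_of_net {E F : Type*} [NormedAddCommGroup E] [NormedSpace ℝ E]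
    [NormedAddCommGroup F] [NormedSpace ℝ F]
    (L : E →L[ℝ] F) {N : Finset E} (hN : ∀ x : E, ‖x‖ = 1 → ∃ w ∈ N, ‖x - w‖ ≤ 1 / 2)
    {r : ℝ} (hr : 0 ≤ r) (hL : ∀ w ∈ N, ‖L w‖ ≤ r) : ‖L‖ ≤ 2 * r := by
  have : ‖L‖ ≤ r + ‖L‖ * (1 / 2) := by
    refine L.opNorm_le_of_unit_norm (by positivity) fun x hx => ?_
    obtain ⟨w, hw, hxw⟩ := hN x hx
    calc ‖L x‖ = ‖L w + L (x - w)‖ := by rw [← map_add]; simp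
      _ ≤ ‖L w‖ + ‖L (x - w)‖ := norm_add_le _ _
      _ ≤ r + ‖L‖ * (1 / 2) := by
          gcongr
          · exact hL w hw
          · exact L.le_opNorm_of_le hxw
  linarith

section Deterministic

variable {m n : ℕ}

/-- The coordinates of `A x` indexed by `S`, as a continuous linear map. -/
noncomputable def rowRestriction (A : Matrix (Fin m) (Fin n) ℝ) (S : Finset (Fin m)) :
    EuclideanSpace ℝ (Fin n) →L[ℝ] EuclideanSpace ℝ S :=
  LinearMap.toContinuousLinearMap
    { toFun := fun x => WithLp.toLp 2 fun i : S => A.mulVec (fun j => x j) i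
      map_add' := fun x y => by
        ext i
        exact congrFun (A.mulVec_add (fun j => x j) fun j => y j) i
      map_smul' := fun c x => by
        ext i
        exact congrFun (A.mulVec_smul c fun j => x j) i }

theorem norm_rowRestriction_sq (A : Matrix (Fin m) (Fin n) ℝ) (S : Finset (Fin m))
    (x : EuclideanSpace ℝ (Fin n)) :
    ‖rowRestriction A S x‖ ^ 2 = ∑ i ∈ S, A.mulVec (fun j => x j) i ^ 2 := by
  rw [EuclideanSpace.real_norm_sq_eq,
    ← Finset.sum_coe_sort S fun i => A.mulVec (fun j => x j) i ^ 2]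
  rfl

/-- Truncation gives y² ≤ max(y² - T, 0) + T entrywise. Summing over `S` bounds the row-restricted
operator on the net, for all `S` under one hypothesis; passing to the operator norm costs the factor
4. -/
theorem sum_sq_le_of_net {A : Matrix (Fin m) (Fin n) ℝ} {N : Finset (EuclideanSpace ℝ (Fin n))}
    (hN : ∀ x, ‖x‖ = 1 → ∃ w ∈ N, ‖x - w‖ ≤ 1 / 2) {T B : ℝ} (hT : 0 ≤ T) (hB : 0 ≤ B)
    (hA : ∀ w ∈ N, ∑ i, max (A.mulVec (fun j => w j) i ^ 2 - T) 0 ≤ B)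
    (S : Finset (Fin m)) (x : EuclideanSpace ℝ (Fin n)) :
    ∑ i ∈ S, A.mulVec (fun j => x j) i ^ 2 ≤ 4 * (B + T * S.card) * ‖x‖ ^ 2 := by
  have hr : 0 ≤ B + T * S.card := by positivity
  have hL : ‖rowRestriction A S‖ ≤ 2 * √(B + T * S.card) := by
    refine opNorm_le_two_mul_of_net _ hN (Real.sqrt_nonneg _) fun w hw => Real.le_sqrt_of_sq_le ?_
    rw [norm_rowRestriction_sq]
    calc _ ≤ ∑ i ∈ S, (max (A.mulVec (fun j => w j) i ^ 2 - T) 0 + T) := by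
          gcongr with i
          linarith [le_max_left (A.mulVec (fun j => w j) i ^ 2 - T) (0 : ℝ)]
      _ = ∑ i ∈ S, max (A.mulVec (fun j => w j) i ^ 2 - T) 0 + T * S.card := by
          simp [Finset.sum_add_distrib, mul_comm]
      _ ≤ ∑ i, max (A.mulVec (fun j => w j) i ^ 2 - T) 0 + T * S.card := by
          gcongr ?_ + _
          exact Finset.sum_le_univ_sum_of_nonneg
            (f := fun i => max (A.mulVec (fun j => w j) i ^ 2 - T) 0) fun i => le_max_right _ _
      _ ≤ _ := by gcongr; exact hA w hw
  rw [← norm_rowRestriction_sq]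
  calc _ ≤ (2 * √(B + T * S.card) * ‖x‖) ^ 2 := by
        gcongr
        exact (rowRestriction A S).le_of_opNorm_le hL x
    _ = _ := by rw [mul_pow, mul_pow, Real.sq_sqrt hr]; ring

/-- For a unit `x` near a net point `w`, an entry of `Ax` below δ forces either an entry of `Aw`
below 2δ or one of A(x - w) of size at least δ. Markov's inequality with `hop` leaves at most m/8 of
the latter. -/
theorem card_lt_norm_le_of_net {A : Matrix (Fin m) (Fin n) ℝ}
    {N : Finset (EuclideanSpace ℝ (Fin n))} {η δ K : ℝ} (hδ : 0 < δ) (hK : 0 ≤ K)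
    (hηK : K * η ^ 2 ≤ δ ^ 2 / 8)
    (hN : ∀ x, ‖x‖ = 1 → ∃ w ∈ N, ‖x - w‖ ≤ η)
    (hA : ∀ w ∈ N, ((Finset.univ.filter fun i => |A.mulVec (fun j => w j) i| < 2 * δ).card : ℝ)
      ≤ m / 8)
    (hop : ∀ x : EuclideanSpace ℝ (Fin n),
      ∑ i, A.mulVec (fun j => x j) i ^ 2 ≤ K * m * ‖x‖ ^ 2)
    (x : EuclideanSpace ℝ (Fin n)) :
    ((Finset.univ.filter fun i => |A.mulVec (fun j => x j) i| < δ * ‖x‖).card : ℝ) ≤ m / 4 := by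
  classical
  have unit : ∀ x : EuclideanSpace ℝ (Fin n), ‖x‖ = 1 →
      ((Finset.univ.filter fun i => |A.mulVec (fun j => x j) i| < δ).card : ℝ) ≤ m / 4 := by
    intro x hx
    obtain ⟨w, hw, hxw⟩ := hN x hx
    set F := Finset.univ.filter fun i => δ ≤ |A.mulVec (fun j => (x - w) j) i| with hF
    have hsplit : ∀ i, A.mulVec (fun j => (x - w) j) i
        = A.mulVec (fun j => x j) i - A.mulVec (fun j => w j) i := fun i =>
      congrFun (A.mulVec_sub (fun j => x j) fun j => w j) i
    have hsub : (Finset.univ.filter fun i => |A.mulVec (fun j => x j) i| < δ) ⊆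
        (Finset.univ.filter fun i => |A.mulVec (fun j => w j) i| < 2 * δ) ∪ F := by
      intro i hi
      simp only [Finset.mem_union, Finset.mem_filter, Finset.mem_univ, true_and, hF, hsplit] at hi ⊢
      by_contra! hcon
      have := abs_sub_abs_le_abs_sub (A.mulVec (fun j => w j) i) (A.mulVec (fun j => x j) i)
      rw [abs_sub_comm] at this
      linarith [hcon.1, hcon.2]
    have hFc : (F.card : ℝ) ≤ m / 8 := by
      have h1 : F.card * δ ^ 2 ≤ K * m * ‖x - w‖ ^ 2 := by
        refine le_trans ?_ (hop (x - w))
        calc (F.card : ℝ) * δ ^ 2 = ∑ _i ∈ F, δ ^ 2 := by simp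
          _ ≤ ∑ i ∈ F, A.mulVec (fun j => (x - w) j) i ^ 2 := by
              refine Finset.sum_le_sum fun i hi => ?_
              rw [← sq_abs (A.mulVec _ i)]
              have := (Finset.mem_filter.1 hi).2
              gcongr
          _ ≤ _ := Finset.sum_le_univ_sum_of_nonneg fun i => sq_nonneg _
      have h2 : K * m * ‖x - w‖ ^ 2 ≤ m / 8 * δ ^ 2 := by
        calc K * m * ‖x - w‖ ^ 2 ≤ K * m * η ^ 2 := by gcongr
          _ = m * (K * η ^ 2) := by ring
          _ ≤ m * (δ ^ 2 / 8) := by gcongr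
          _ = _ := by ring
      exact le_of_mul_le_mul_right (h1.trans h2) (by positivity)
    have hc : ((Finset.univ.filter fun i => |A.mulVec (fun j => x j) i| < δ).card : ℝ) ≤
        (Finset.univ.filter fun i => |A.mulVec (fun j => w j) i| < 2 * δ).card + F.card :=
      mod_cast (Finset.card_le_card hsub).trans (Finset.card_union_le _ _)
    linarith [hA w hw]
  rcases eq_or_ne x 0 with rfl | hx
  · rw [Finset.filter_false_of_mem fun i _ => by simp, Finset.card_empty, Nat.cast_zero]
    positivity
  · have hx' : 0 < ‖x‖ := norm_pos_iff.2 hx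
    have h := unit (‖x‖⁻¹ • x) (norm_smul_inv_norm hx)
    have hs : ∀ i, A.mulVec (fun j => (‖x‖⁻¹ • x) j) i = ‖x‖⁻¹ * A.mulVec (fun j => x j) i :=
      fun i => congrFun (A.mulVec_smul ‖x‖⁻¹ fun j => x j) i
    have he : ∀ i, |A.mulVec (fun j => (‖x‖⁻¹ • x) j) i| < δ ↔
        |A.mulVec (fun j => x j) i| < δ * ‖x‖ := fun i => by
      rw [hs, abs_mul, abs_of_pos (inv_pos.2 hx'), inv_mul_lt_iff₀ hx', mul_comm δ]
    simpa only [he] using h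

end Deterministic

/-! ### Sharpness from the two uniform bounds -/

section Sharpness

theorem infDist_pair {E : Type*} [PseudoMetricSpace E] (x a b : E) :
    Metric.infDist x {a, b} = min (dist x a) (dist x b) := by
  refine le_antisymm (le_min (Metric.infDist_le_dist_of_mem (by simp))
    (Metric.infDist_le_dist_of_mem (by simp))) ?_
  rw [Metric.le_infDist (by simp)]
  simp

theorem minimizerSet_eq_and_isSharpWith {E : Type*} [NormedAddCommGroup E] {f : E → ℝ} {μ : ℝ}
    (hμ : 0 < μ) (z : E) (heven : f (-z) = f z)
    (hf : ∀ x, f z + μ * min ‖x - z‖ ‖x + z‖ ≤ f x) :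
    minimizerSet f = {z, -z} ∧ IsSharpWith f μ := by
  have hmin : ∀ x, f z ≤ f x := fun x => by
    have : 0 ≤ μ * min ‖x - z‖ ‖x + z‖ := by positivity
    linarith [hf x]
  have hset : minimizerSet f = {z, -z} := by
    ext x
    simp only [minimizerSet, Set.mem_ofPred_eq, Set.mem_insert_iff, Set.mem_singleton_iff]
    constructor
    · intro hx
      have h1 : min ‖x - z‖ ‖x + z‖ ≤ 0 := by
        by_contra! hpos
        have := mul_pos hμ hpos
        linarith [hf x, hx z]
      rcases min_le_iff.1 h1 with h | h
      · exact Or.inl (sub_eq_zero.1 (norm_le_zero_iff.1 h))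
      · exact Or.inr (eq_neg_of_add_eq_zero_left (norm_le_zero_iff.1 h))
    · rintro (rfl | rfl)
      · exact hmin
      · rw [heven]; exact hmin
  refine ⟨hset, hμ, by rw [hset]; simp, fun x => ?_⟩
  have hinf : ⨅ y, f y ≤ f z := ciInf_le ⟨f z, by rintro _ ⟨y, rfl⟩; exact hmin y⟩ z
  rw [hset, infDist_pair, dist_eq_norm, dist_eq_norm, sub_neg_eq_add]
  linarith [hf x]

end Sharpness

section Deterministic

variable {m n : ℕ}

theorem phaseObjective_neg (p : ℕ) (A : Matrix (Fin m) (Fin n) ℝ) (b : Fin m → ℝ)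
    (x : EuclideanSpace ℝ (Fin n)) : phaseObjective p A b (-x) = phaseObjective p A b x := by
  have h : ∀ i, A.mulVec (fun j => (-x) j) i = -A.mulVec (fun j => x j) i := fun i =>
    congrFun (A.mulVec_neg fun j => x j) i
  simp only [phaseObjective, phaseResidual, h, abs_neg]

/-- Where the residual of `z` vanishes, the summand grows by exactly the difference; elsewhere it
drops by at most that much. -/
theorem phaseObjective_add_le (p : ℕ) (A : Matrix (Fin m) (Fin n) ℝ) (b : Fin m → ℝ)
    (x z : EuclideanSpace ℝ (Fin n)) :
    phaseObjective p A b z + (1 / (m : ℝ)) *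
      (∑ i, |(|A.mulVec (fun j => x j) i| ^ p - |A.mulVec (fun j => z j) i| ^ p)|
        - 2 * ∑ i with phaseResidual p A b z i ≠ 0,
          |(|A.mulVec (fun j => x j) i| ^ p - |A.mulVec (fun j => z j) i| ^ p)|)
      ≤ phaseObjective p A b x := by
  unfold phaseObjective
  rw [← mul_add]
  refine mul_le_mul_of_nonneg_left ?_ (by positivity)
  rw [Finset.sum_filter, Finset.mul_sum, ← Finset.sum_sub_distrib, ← Finset.sum_add_distrib]
  refine Finset.sum_le_sum fun i _ => ?_
  have hD : |A.mulVec (fun j => x j) i| ^ p - |A.mulVec (fun j => z j) i| ^ p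
      = phaseResidual p A b x i - phaseResidual p A b z i := by
    simp [phaseResidual]
  rw [hD]
  split_ifs with h
  · have := abs_sub_abs_le_abs_sub (phaseResidual p A b z i) (phaseResidual p A b x i)
    rw [abs_sub_comm] at this
    linarith
  · rw [not_not.1 h]; simp

theorem abs_abs_sub_abs_eq_min (a c : ℝ) : |(|a| - |c|)| = min |a - c| |a + c| := by
  rcases le_total 0 a with ha | ha <;> rcases le_total 0 c with hc | hc <;>
    simp only [abs_of_nonneg, abs_of_nonpos, ha, hc]
  · rw [min_eq_left]
    rw [abs_of_nonneg (add_nonneg ha hc), abs_le]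
    constructor <;> linarith
  · rw [sub_neg_eq_add, min_eq_right]
    rw [abs_of_nonneg (by linarith : 0 ≤ a - c), abs_le]
    constructor <;> linarith
  · rw [← abs_neg, min_eq_right]
    · congr 1; ring
    · rw [abs_of_nonpos (by linarith : a - c ≤ 0), abs_le]
      constructor <;> linarith
  · rw [← abs_neg, min_eq_left]
    · congr 1; ring
    · rw [abs_of_nonpos (by linarith : a + c ≤ 0), abs_le]
      constructor <;> linarith

theorem abs_abs_sq_sub_abs_sq (a c : ℝ) : |(|a| ^ 2 - |c| ^ 2)| = |a - c| * |a + c| := by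
  rw [sq_abs, sq_abs, ← abs_mul]
  ring_nf

theorem le_sum_of_card_lt_le {D : Fin m → ℝ} {F G : Finset (Fin m)} {q : ℝ} (hq : 0 ≤ q)
    (hD : ∀ i, 0 ≤ D i) (hF : (F.card : ℝ) ≤ m / 4) (hG : (G.card : ℝ) ≤ m / 4)
    (h : ∀ i, i ∉ F → i ∉ G → q ≤ D i) : m / 2 * q ≤ ∑ i, D i := by
  classical
  have hc : (m : ℝ) / 2 ≤ ((F ∪ G)ᶜ).card := by
    have h1 : ((F ∪ G).card : ℝ) ≤ F.card + G.card := mod_cast Finset.card_union_le F G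
    have h2 : ((F ∪ G).card : ℝ) + ((F ∪ G)ᶜ).card = m := by
      have := Finset.card_add_card_compl (F ∪ G)
      rw [Fintype.card_fin] at this
      exact_mod_cast this
    linarith
  calc (m : ℝ) / 2 * q ≤ ((F ∪ G)ᶜ).card * q := by gcongr
    _ = ∑ _i ∈ (F ∪ G)ᶜ, q := by simp
    _ ≤ ∑ i ∈ (F ∪ G)ᶜ, D i := Finset.sum_le_sum fun i hi => by
        rw [Finset.mem_compl, Finset.mem_union, not_or] at hi
        exact h i hi.1 hi.2
    _ ≤ _ := Finset.sum_le_univ_sum_of_nonneg hD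

/-- The larger of the two distances is at least `‖z‖`, because 2z = (x + z) - (x - z). -/
theorem norm_mul_min_le {E : Type*} [NormedAddCommGroup E] [NormedSpace ℝ E] (x z : E) :
    ‖z‖ * min ‖x - z‖ ‖x + z‖ ≤ ‖x - z‖ * ‖x + z‖ := by
  rw [← max_mul_min ‖x - z‖ ‖x + z‖]
  gcongr
  have h : ‖(2 : ℝ) • z‖ ≤ ‖x + z‖ + ‖x - z‖ := by
    rw [show (2 : ℝ) • z = (x + z) - (x - z) by rw [two_smul]; abel]
    exact norm_sub_le _ _
  rw [norm_smul, Real.norm_of_nonneg zero_le_two] at h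
  linarith [le_max_left ‖x - z‖ ‖x + z‖, le_max_right ‖x - z‖ ‖x + z‖]

theorem sharp_phaseObjective {p : ℕ} (hp : p = 1 ∨ p = 2) (hm : 0 < m)
    {A : Matrix (Fin m) (Fin n) ℝ} {δ s : ℝ} (hδ : 0 < δ) (hs : s ≤ 1 / 8)
    (hlow : ∀ x : EuclideanSpace ℝ (Fin n),
      ((Finset.univ.filter fun i => |A.mulVec (fun j => x j) i| < δ * ‖x‖).card : ℝ) ≤ m / 4)
    (hup : ∀ S : Finset (Fin m), (S.card : ℝ) ≤ s * m → ∀ x : EuclideanSpace ℝ (Fin n),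
      ∑ i ∈ S, A.mulVec (fun j => x j) i ^ 2 ≤ δ ^ 2 / 8 * m * ‖x‖ ^ 2)
    (z : EuclideanSpace ℝ (Fin n)) (b : Fin m → ℝ) (hz : p = 2 → z ≠ 0)
    (hb : (hammingNorm (phaseResidual p A b z) : ℝ) ≤ s * m) :
    minimizerSet (phaseObjective p A b) = {z, -z} ∧
      IsSharpWith (phaseObjective p A b) (δ ^ p / 4 * ‖z‖ ^ (p - 1)) := by
  classical
  have hm' : (0 : ℝ) < m := mod_cast hm
  set S := Finset.univ.filter fun i => phaseResidual p A b z i ≠ 0 with hS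
  have hSc : (S.card : ℝ) ≤ s * m := by
    simpa only [hammingNorm] using hb
  refine minimizerSet_eq_and_isSharpWith ?_ z (phaseObjective_neg p A b z) fun x => ?_
  · rcases hp with rfl | rfl
    · simp; positivity
    · have := norm_pos_iff.2 (hz rfl)
      positivity
  refine le_trans ?_ (phaseObjective_add_le p A b x z)
  rw [← hS]
  have hsub : ∀ i, A.mulVec (fun j => x j) i - A.mulVec (fun j => z j) i
      = A.mulVec (fun j => (x - z) j) i := fun i =>
    (congrFun (A.mulVec_sub (fun j => x j) fun j => z j) i).symm
  have hadd : ∀ i, A.mulVec (fun j => x j) i + A.mulVec (fun j => z j) i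
      = A.mulVec (fun j => (x + z) j) i := fun i =>
    (congrFun (A.mulVec_add (fun j => x j) fun j => z j) i).symm
  -- The margin is 1/2 - 2 · 1/8 = 1/4. The witness `q` is the minimum of the two distances for p =
  -- 1 and their product for p = 2.
  suffices key : ∃ q, ‖z‖ ^ (p - 1) * min ‖x - z‖ ‖x + z‖ ≤ q ∧
      m / 2 * (δ ^ p * q) ≤
        ∑ i, |(|A.mulVec (fun j => x j) i| ^ p - |A.mulVec (fun j => z j) i| ^ p)| ∧
      ∑ i ∈ S, |(|A.mulVec (fun j => x j) i| ^ p - |A.mulVec (fun j => z j) i| ^ p)|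
        ≤ m / 8 * (δ ^ p * q) by
    obtain ⟨q, hq, h1, h2⟩ := key
    refine add_le_add_right ?_ _
    calc δ ^ p / 4 * ‖z‖ ^ (p - 1) * min ‖x - z‖ ‖x + z‖
        = δ ^ p / 4 * (‖z‖ ^ (p - 1) * min ‖x - z‖ ‖x + z‖) := by ring
      _ ≤ δ ^ p / 4 * q := by gcongr
      _ = 1 / m * (m / 2 * (δ ^ p * q) - 2 * (m / 8 * (δ ^ p * q))) := by
          field_simp
          ring
      _ ≤ _ := by gcongr
  rcases hp with rfl | rfl
  · simp only [pow_one, abs_abs_sub_abs_eq_min, hsub, hadd]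
    refine ⟨min ‖x - z‖ ‖x + z‖, by simp, ?_, ?_⟩
    · refine le_sum_of_card_lt_le (by positivity) (fun i => by positivity) (hlow (x - z))
        (hlow (x + z)) fun i h1 h2 => ?_
      simp only [Finset.mem_filter, Finset.mem_univ, true_and, not_lt] at h1 h2
      rw [mul_min_of_nonneg _ _ hδ.le]
      exact min_le_min h1 h2
    · have hl1 : ∀ y : EuclideanSpace ℝ (Fin n),
          ∑ i ∈ S, |A.mulVec (fun j => y j) i| ≤ m / 8 * (δ * ‖y‖) := fun y => by
        -- Cauchy–Schwarz with at most m/8 rows in `S`; the constants multiply to (δ/8)².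
        refine le_of_sq_le_sq ?_ (by positivity)
        calc _ ≤ S.card * ∑ i ∈ S, |A.mulVec (fun j => y j) i| ^ 2 := sq_sum_le_card_mul_sum_sq
          _ ≤ (1 / 8 * m) * (δ ^ 2 / 8 * m * ‖y‖ ^ 2) := by
              simp only [sq_abs]
              have := hup S hSc y
              gcongr
              exact hSc.trans (by gcongr)
          _ = _ := by ring
      rcases min_choice ‖x - z‖ ‖x + z‖ with h | h <;> rw [h]
      · exact (Finset.sum_le_sum fun i _ => min_le_left _ _).trans (hl1 _)
      · exact (Finset.sum_le_sum fun i _ => min_le_right _ _).trans (hl1 _)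
  · simp only [abs_abs_sq_sub_abs_sq, hsub, hadd]
    refine ⟨‖x - z‖ * ‖x + z‖, by simpa using norm_mul_min_le x z, ?_, ?_⟩
    · refine le_sum_of_card_lt_le (by positivity) (fun i => by positivity) (hlow (x - z))
        (hlow (x + z)) fun i h1 h2 => ?_
      simp only [Finset.mem_filter, Finset.mem_univ, true_and, not_lt] at h1 h2
      calc δ ^ 2 * (‖x - z‖ * ‖x + z‖) = (δ * ‖x - z‖) * (δ * ‖x + z‖) := by ring
        _ ≤ _ := by gcongr
    · refine le_of_sq_le_sq ?_ (by positivity)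
      refine (Finset.sum_mul_sq_le_sq_mul_sq _ _ _).trans ?_
      simp only [sq_abs]
      calc _ ≤ (δ ^ 2 / 8 * m * ‖x - z‖ ^ 2) * (δ ^ 2 / 8 * m * ‖x + z‖ ^ 2) := by
            have h1 := hup S hSc (x - z)
            have h2 := hup S hSc (x + z)
            gcongr
        _ = _ := by ring

end Deterministic

/-! ### The high-probability event and the choice of constants -/

/-- A vector with small truncated energy and few small entries, up to the given thresholds. -/
def IsTypicalImage {m : ℕ} (T δ β : ℝ) (y : Fin m → ℝ) : Prop :=
  ∑ i, max (y i ^ 2 - T) 0 ≤ 4 * (β * m) ∧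
    ((Finset.univ.filter fun i => |y i| < 2 * δ).card : ℝ) ≤ m / 8

/-- Two Chernoff bounds. Weight 8 per small entry turns a count above m/8 into a sum above m,
against an exponential moment rate of only 1/2. -/
theorem IsStdGaussianMatrix.measureReal_not_isTypicalImage_le {Ω : Type*} [MeasurableSpace Ω]
    {P : Measure Ω} [IsProbabilityMeasure P] {m n : ℕ} {A : Ω → Matrix (Fin m) (Fin n) ℝ}
    (hA : IsStdGaussianMatrix A P) {T δ β : ℝ}
    (hT : ∫ x, Real.exp (max (x ^ 2 - T) 0 / 4) ∂(gaussianReal 0 1) ≤ Real.exp (β / 2))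
    (hδi : Integrable (fun x : ℝ => Real.exp (if |x| < 2 * δ then 8 else 0)) (gaussianReal 0 1))
    (hδ : ∫ x, Real.exp (if |x| < 2 * δ then 8 else 0) ∂(gaussianReal 0 1) ≤ Real.exp (1 / 2))
    {w : EuclideanSpace ℝ (Fin n)} (hw : ‖w‖ = 1) :
    P.real {ω | ¬ IsTypicalImage T δ β ((A ω).mulVec fun j => w j)} ≤
      Real.exp (-(β / 2) * m) + Real.exp (-(1 / 2) * m) := by
  have h1 := measureReal_mul_le_sum_le (hA.hasLaw_mulVec hw) (hA.iIndepFun_mulVec _)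
    (h := fun x => max (x ^ 2 - T) 0 / 4) (by fun_prop) (integrable_exp_max_gaussianReal T) hT β
  have h2 := measureReal_mul_le_sum_le (hA.hasLaw_mulVec hw) (hA.iIndepFun_mulVec _)
    (h := fun x => if |x| < 2 * δ then 8 else 0)
    (Measurable.ite (measurableSet_lt (by fun_prop) (by fun_prop)) (by fun_prop) (by fun_prop))
    hδi hδ 1
  rw [show β / 2 - β = -(β / 2) by ring] at h1
  rw [show (1 / 2 - 1 : ℝ) = -(1 / 2) by norm_num] at h2
  refine le_trans (measureReal_mono ?_) ((measureReal_union_le _ _).trans (add_le_add h1 h2))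
  intro ω hω
  simp only [Set.mem_ofPred_eq, Set.mem_union] at hω ⊢
  contrapose! hω
  obtain ⟨h3, h4⟩ := hω
  constructor
  · rw [← Finset.sum_div] at h3
    linarith
  · rw [← Finset.sum_filter, Finset.sum_const, nsmul_eq_mul] at h4
    linarith

/-- The bad set need not be measurable, so `G` is the complement of its measurable hull. -/
theorem exists_measurableSet_compl_of_measureReal_le {Ω : Type*} [MeasurableSpace Ω]
    {P : Measure Ω} [IsProbabilityMeasure P] {B : Set Ω} {q : ℝ} (hq : 0 ≤ q)
    (hB : P.real B ≤ q) :
    ∃ G, MeasurableSet G ∧ ENNReal.ofReal (1 - q) ≤ P G ∧ G ⊆ Bᶜ := by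
  refine ⟨(toMeasurable P B)ᶜ, (measurableSet_toMeasurable P B).compl, ?_,
    Set.compl_subset_compl.2 (subset_toMeasurable P B)⟩
  rw [prob_compl_eq_one_sub (measurableSet_toMeasurable P B), measure_toMeasurable,
    ENNReal.ofReal_sub _ hq, ENNReal.ofReal_one]
  refine tsub_le_tsub_left ?_ _
  rw [← ofReal_measureReal]
  exact ENNReal.ofReal_le_ofReal hB

theorem pow_mul_exp_le {R c : ℝ} (hR : 1 < R) (hc : 0 < c) {m n : ℕ}
    (hmn : 2 * Real.log R / c * n ≤ m) :
    R ^ n * (2 * Real.exp (-c * m)) ≤ 2 * Real.exp (-(c / 2) * m) := by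
  have hRn : R ^ n = Real.exp (n * Real.log R) := by
    rw [Real.exp_nat_mul, Real.exp_log (by linarith)]
  have h : n * Real.log R ≤ c / 2 * m := by
    rw [div_mul_eq_mul_div, div_le_iff₀ hc] at hmn
    linarith
  rw [hRn]
  calc _ = 2 * Real.exp (n * Real.log R + -c * m) := by rw [Real.exp_add]; ring
    _ ≤ _ := by
        gcongr
        linarith

theorem theorem5p2 (p : ℕ) (hp : p = 1 ∨ p = 2) :
    ∃ C c₀ c₁ s κ : ℝ, 0 < C ∧ 0 < c₀ ∧ 0 < c₁ ∧ 0 < s ∧ s < 1 ∧ 0 < κ ∧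
      ∀ (m n : ℕ), c₀ * (n : ℝ) ≤ (m : ℝ) →
      ∀ (Ω : Type*) [MeasurableSpace Ω] (P : Measure Ω) [IsProbabilityMeasure P]
        (A : Ω → Matrix (Fin m) (Fin n) ℝ), IsStdGaussianMatrix A P →
      ∃ G : Set Ω, MeasurableSet G ∧
        ENNReal.ofReal (1 - C * Real.exp (-c₁ * (m : ℝ))) ≤ P G ∧
        ∀ ω ∈ G, ∀ (xs : EuclideanSpace ℝ (Fin n)) (b : Fin m → ℝ),
          (p = 2 → xs ≠ 0) →
          (hammingNorm (phaseResidual p (A ω) b xs) : ℝ) ≤ s * (m : ℝ) →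
          minimizerSet (phaseObjective p (A ω) b) = {xs, -xs} ∧
          IsSharpWith (phaseObjective p (A ω) b) (κ * ‖xs‖ ^ (p - 1)) := by
  obtain ⟨r, hr, hri, hrε⟩ := exists_integral_exp_indicator_le 8 (ε := 1 / 2) (by norm_num)
  obtain ⟨δ, rfl⟩ : ∃ δ, r = 2 * δ := ⟨r / 2, by ring⟩
  have hδ : 0 < δ := by linarith
  -- With `hsT`, this makes 4(4β + T s) ≤ δ²/8, the energy allowed on a set of `s m` rows.
  set β := δ ^ 2 / 256 with hβ
  have hβ0 : 0 < β := by positivity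
  obtain ⟨T, hT, hTε⟩ := exists_integral_exp_max_le (half_pos hβ0)
  set s := min (1 / 8) (δ ^ 2 / (64 * T)) with hs
  have hs0 : 0 < s := by positivity
  have hsT : T * s ≤ δ ^ 2 / 64 := by
    calc T * s ≤ T * (δ ^ 2 / (64 * T)) := by gcongr; exact min_le_right _ _
      _ = _ := by field_simp
  set K := 4 * (4 * β + T) with hK
  have hK0 : 0 < K := by positivity
  -- One net serves both extensions: η ≤ 1/2 for the operator norm, and Kη² ≤ Kη ≤ δ²/8 for counting
  -- small entries.
  set η := min (1 / 2) (δ ^ 2 / (8 * K)) with hη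
  have hη0 : 0 < η := by positivity
  have hη1 : η ≤ 1 / 2 := min_le_left _ _
  have hηK : K * η ^ 2 ≤ δ ^ 2 / 8 := by
    calc K * η ^ 2 ≤ K * η := by gcongr; nlinarith
      _ ≤ K * (δ ^ 2 / (8 * K)) := by gcongr; exact min_le_right _ _
      _ = _ := by field_simp
  set R := 1 + 2 / η with hR
  have hR1 : 1 < R := by
    have : 0 < 2 / η := by positivity
    linarith
  set c := min (β / 2) (1 / 2) with hc
  have hc0 : 0 < c := by positivity
  have hlog := Real.log_pos hR1
  refine ⟨2, 2 * Real.log R / c, c / 2, s, δ ^ p / 4, two_pos, by positivity, by positivity, hs0,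
    (min_le_left _ _).trans_lt (by norm_num), by positivity, ?_⟩
  intro m n hmn Ω _ P _ A hA
  -- For m = 0 the required probability 1 - 2 is negative, so the empty event suffices.
  rcases m.eq_zero_or_pos with rfl | hm
  · refine ⟨∅, MeasurableSet.empty, ?_, by simp⟩
    norm_num
  obtain ⟨N, hN1, hN, hNc⟩ := exists_net_sphere (E := EuclideanSpace ℝ (Fin n)) hη0
  rw [finrank_euclideanSpace_fin] at hNc
  have hfail : P.real (⋃ w ∈ N, {ω | ¬ IsTypicalImage T δ β ((A ω).mulVec fun j => w j)}) ≤
      2 * Real.exp (-(c / 2) * m) := by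
    refine le_trans ?_ (pow_mul_exp_le hR1 hc0 hmn)
    calc _ ≤ ∑ w ∈ N, P.real {ω | ¬ IsTypicalImage T δ β ((A ω).mulVec fun j => w j)} :=
          measureReal_biUnion_finset_le _ _
      _ ≤ ∑ w ∈ N, 2 * Real.exp (-c * m) := by
          refine Finset.sum_le_sum fun w hw =>
            (hA.measureReal_not_isTypicalImage_le hTε hri hrε (hN1 w hw)).trans ?_
          rw [two_mul]
          gcongr
          · exact min_le_left _ _
          · exact min_le_right _ _
      _ = N.card * (2 * Real.exp (-c * m)) := by simp
      _ ≤ _ := by gcongr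
  obtain ⟨G, hGm, hGP, hGB⟩ := exists_measurableSet_compl_of_measureReal_le (by positivity) hfail
  refine ⟨G, hGm, hGP, fun ω hω z b hz hb => ?_⟩
  have hgood : ∀ w ∈ N, IsTypicalImage T δ β ((A ω).mulVec fun j => w j) := by
    simpa using hGB hω
  have hsum := sum_sq_le_of_net (fun x hx => (hN x hx).imp fun w h => ⟨h.1, h.2.trans hη1⟩) hT.le
    (by positivity : 0 ≤ 4 * (β * m)) fun w hw => (hgood w hw).1
  refine sharp_phaseObjective hp hm hδ (min_le_left _ _) ?_ ?_ z b hz hb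
  · refine card_lt_norm_le_of_net hδ hK0.le hηK hN (fun w hw => (hgood w hw).2) fun x =>
      (hsum Finset.univ x).trans (le_of_eq ?_)
    rw [Finset.card_fin, hK]
    ring
  · intro S hS x
    refine (hsum S x).trans (mul_le_mul_of_nonneg_right ?_ (sq_nonneg _))
    have h1 : T * S.card ≤ δ ^ 2 / 64 * m := by
      calc T * S.card ≤ T * (s * m) := by gcongr
        _ = T * s * m := by ring
        _ ≤ _ := by gcongr
    have h2 : 4 * (β * m) = δ ^ 2 / 64 * m := by rw [hβ]; ring
    linarith
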